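/- **Setting.** A *quad-graph* here is a finite connected graph $G$ with at least one edge (multiple edges allowed) embedded in the plane. Some faces, among them the outer face, are *holes*, of degree at least $2$; all other faces are *quads*, of degree $4$. $G$ is proper (at any vertex at most two edge ends bound a given face), and holes do not share edges (every edge lies on a quad). A *strip* is a maximal sequence of quads that enters and leaves each of its quads through opposite edges; it is represented by a curve, and the edges crossed by the curve are its *pieces*. A strip is *closed* if it never reaches a hole; strips may intersect themselves. Let $s$ be the number of strips and $h$ the number of holes other than the outer face. Assume that no strip is closed. **Colouring procedure.** At each stage some pieces are green. A piece that is not green is *red* if its curve has a green piece, and *orange* otherwise. A vertex is *known* if it is an initial vertex or an end of an edge crossed by a green piece. An *enclosing* piece is one that crosses an edge with one known and one unknown end. The rules are: * Rule 0: a piece whose edge has both ends known may be coloured green. * Rule 1: if the pieces crossing two adjacent sides of a quad are green, the pieces crossing the other two sides are coloured green. * Rule 2: if all pieces but one entering a hole are green, the remaining one is coloured green. Start with one initial vertex, giving $G_1$, and no green pieces. For $i=1,\dots,s-h$ (so $h\le s$), obtain $G_{i+1}$ from $G_i$ by colouring green one orange enclosing piece of $G_i$, which makes the unknown end of its edge a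 new initial vertex, and then applying Rules 0, 1, 2 until they give nothing new. Here $G_i$ denotes the subgraph of known vertices and green edges at that stage. **Entanglement.** An *exit* of $G_i$ is a quad at which a curve passes from a green piece to a red one while the other two sides of the quad are crossed by red enclosing pieces; these two form the *pair* $P$ of the exit. A set of curves $\{C_1,\dots,C_j\}$, $j\ge1$, leaving $G_i$ is *entangled* if there are exits with pairs $P_1,\dots,P_{j+1}$, the exit of $P_{j+1}$ being that of $P_1$, such that for $k=1,\dots,j$ the curve $C_k$ contains $P_k$, and following $C_k$ from $P_k$ in one of its directions over red pieces one arrives back at $G_i$ at the exit with pair $P_{k+1}$, where $C_k$ is the curve that passes from green to red. **Relations and well-posedness.** Let $\mathbb K$ be an infinite field. On each quad a relation $F(u_1,u_2,u_3,u_4)=0$ is imposed between the values of $u:\mathcal V(G)\to\mathbb K$ at its four vertices, where $F$ is a polynomial of degree at most $1$ in each variable. A solution is a $u$ that satisfies all these relations. The initial value problem (IVP) on a vertex set $I$, prescribing $u|_I$, is *well-posed* for given relations if for generic initial values there is exactly one solution. "Generic" means: outside the zero set of some nonzero polynomial. **Theorem.** Suppose that, in a run of the colouring procedure as above, Rule 0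 or Rule 2 is applied to an orange piece (thereby starting to colour an orange curve green) exactly $h$ times in total, and that for every $i=1,\dots,s+1-h$ no set of curves leaving $G_i$ is entangled. Then the set $I$ of initial vertices has $s+1-h$ elements, and for generic coefficients of the multi-affine relations on the quads the IVP on $I$ is well-posed. -/

import Mathlib

open scoped BigOperators

/-- A finite connected graph drawn on an oriented closed surface, given in the standard way as a
combinatorial map. The elements of `D` are the darts (edges with a direction), `rev` reverses a
dart, and `next d` is the dart that follows `d` on the boundary of the face to the left of `d`. -/
structure CombMap (D : Type*) where
  rev : Equiv.Perm D
  next : Equiv.Perm D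
  rev_rev : ∀ d, rev (rev d) = d
  rev_ne : ∀ d, rev d ≠ d

namespace CombMap

variable {D : Type*} (M : CombMap D)

/-- Rotation of the darts around their starting point. -/
def rot : Equiv.Perm D := M.next * M.rev

/-- Vertices, edges and faces are the orbits of `rot`, `rev` and `next`. -/
def Vertex : Type _ := Quotient (Equiv.Perm.SameCycle.setoid M.rot)

def Edge : Type _ := Quotient (Equiv.Perm.SameCycle.setoid M.rev)

def Face : Type _ := Quotient (Equiv.Perm.SameCycle.setoid M.next)

/-- The vertex at which a dart starts. -/
def tail (d : D) : M.Vertex := Quotient.mk (Equiv.Perm.SameCycle.setoid M.rot) d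

/-- The vertex at which a dart ends. -/
def head (d : D) : M.Vertex := M.tail (M.rev d)

/-- The undirected edge of a dart. -/
def edge (d : D) : M.Edge := Quotient.mk (Equiv.Perm.SameCycle.setoid M.rev) d

/-- The face to the left of a dart. -/
def face (d : D) : M.Face := Quotient.mk (Equiv.Perm.SameCycle.setoid M.next) d

/-- The number of edges on the boundary of a face (with multiplicity). -/
noncomputable def faceDegree (f : M.Face) : ℕ := Nat.card {d : D // M.face d = f}

/-- The underlying graph is connected. -/
def Connected : Prop :=
  ∀ x y : M.Vertex, Relation.ReflTransGen (fun a b => ∃ d, M.tail d = a ∧ M.head d = b) x y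

/-- The surface is the sphere: the Euler characteristic is 2. -/
def Planar : Prop :=
  (Nat.card M.Vertex : ℤ) - Nat.card M.Edge + Nat.card M.Face = 2

end CombMap

/-- A finite, connected, proper, not necessarily simply connected quad-graph. Multiple edges are
allowed. -/
structure QuadGraph (D : Type*) extends CombMap D where
  connected : toCombMap.Connected
  planar : toCombMap.Planar
  /-- The holes. -/
  hole : Set toCombMap.Face
  /-- The outer face, which counts as a hole. -/
  outer : toCombMap.Face
  outer_hole : outer ∈ hole
  /-- The faces that are not holes are quads. -/
  quad_degree : ∀ f, f ∉ hole → toCombMap.faceDegree f = 4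
  hole_degree : ∀ f ∈ hole, 1 < toCombMap.faceDegree f
  /-- Properness: the boundary of a face passes through each vertex at most once, so at any vertex
  at most two edge ends bound a given face. -/
  proper : ∀ d d' : D, toCombMap.face d = toCombMap.face d' →
    toCombMap.tail d = toCombMap.tail d' → d = d'
  /-- Holes do not share edges: every edge lies on a quad. -/
  hole_edge : ∀ d : D, ¬ (toCombMap.face d ∈ hole ∧ toCombMap.face (toCombMap.rev d) ∈ hole)

namespace QuadGraph

variable {D : Type*} (G : QuadGraph D)

/-- The quads. -/
def Quad : Type _ := {f : G.Face // f ∉ G.hole}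

/-- The number of holes, the outer one excluded. -/
noncomputable def numInnerHoles : ℕ := Nat.card {f : G.Face // f ∈ G.hole ∧ f ≠ G.outer}

/-! ### Strips

A strip crosses a quad from an edge to the opposite edge. It is described by the set of edges that
it crosses; these edges are the pieces of the curve that represents the strip. -/

/-- Two edges that are opposite to each other on a quad. -/
def Opposite (e e' : G.Edge) : Prop :=
  ∃ d : D, G.face d ∉ G.hole ∧ G.edge d = e ∧ G.edge (G.next (G.next d)) = e'

/-- The strips, as equivalence classes of edges. -/
def Strip : Type _ := Quotient (Relation.EqvGen.setoid G.Opposite)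

/-- The strip that crosses a given edge. -/
def strip (e : G.Edge) : G.Strip := Quotient.mk (Relation.EqvGen.setoid G.Opposite) e

noncomputable def numStrips : ℕ := Nat.card G.Strip

/-- A strip is closed if it never arrives at a hole. -/
def ClosedStrip (C : G.Strip) : Prop := ∀ d : D, G.strip (G.edge d) = C → G.face d ∉ G.hole

/-! ### Colourings of the pieces of curves -/

/-- The vertices chosen as initial values and the edges whose pieces of curve are green. -/
structure Colouring where
  init : Set G.Vertex
  green : Set G.Edge

namespace Colouring

variable {G} (S : G.Colouring)

/-- The vertices with known values: the initial ones and the ends of edges crossed by green pieces.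
They are the vertices of the subgraph determined so far. -/
def known : Set G.Vertex :=
  S.init ∪ {x | ∃ d : D, G.edge d ∈ S.green ∧ G.tail d = x}

/-- Colour some pieces green. -/
def colour (P : Set G.Edge) : G.Colouring := ⟨S.init, S.green ∪ P⟩

/-- A piece is orange if its whole curve has no green piece. -/
def Orange (e : G.Edge) : Prop := ∀ e', G.strip e' = G.strip e → e' ∉ S.green

/-- A piece is red if it is not green but its curve has a green piece. -/
def Red (e : G.Edge) : Prop := e ∉ S.green ∧ ∃ e' ∈ S.green, G.strip e' = G.strip e

/-- An enclosing piece crosses an edge with one known and one unknown end. -/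
def Enclosing (e : G.Edge) : Prop :=
  ∃ d : D, G.edge d = e ∧ G.tail d ∈ S.known ∧ G.head d ∉ S.known

/-- Rule 0 applies to a piece if it crosses an edge whose vertices are known. -/
def Rule0 (e : G.Edge) : Prop :=
  ∃ d : D, G.edge d = e ∧ G.tail d ∈ S.known ∧ G.head d ∈ S.known

/-- Rule 1 applies at the quad to the left of `d` if the pieces that cross `d` and the adjacent
side `next d` are green; it colours the pieces that cross the other two sides. -/
def Rule1 (d : D) : Prop :=
  G.face d ∉ G.hole ∧ G.edge d ∈ S.green ∧ G.edge (G.next d) ∈ S.green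

/-- The pieces that are coloured by Rule 1. -/
def rule1Pieces (d : D) : Set G.Edge :=
  {G.edge (G.next (G.next d)), G.edge (G.next (G.next (G.next d)))}

/-- Rule 2 applies to a piece that enters a hole if all other pieces entering it are green. -/
def Rule2 (e : G.Edge) : Prop :=
  ∃ d : D, G.edge d = e ∧ G.face d ∈ G.hole ∧
    ∀ d' : D, G.face d' = G.face d → G.edge d' ≠ e → G.edge d' ∈ S.green

/-- `Propagates S n T`: the colouring `T` arises from `S` by finitely many applications of Rules
0, 1 and 2, and in doing so Rule 0 or 2 is applied exactly `n` times to colour an orange curve. -/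
inductive Propagates (S : G.Colouring) : ℕ → G.Colouring → Prop
  | refl : Propagates S 0 S
  | rule1 {n : ℕ} {T : G.Colouring} (d : D) : Propagates S n T → T.Rule1 d →
      Propagates S n (T.colour (rule1Pieces d))
  | rule02_orange {n : ℕ} {T : G.Colouring} (e : G.Edge) : Propagates S n T →
      (T.Rule0 e ∨ T.Rule2 e) → T.Orange e → Propagates S (n + 1) (T.colour {e})
  | rule02_red {n : ℕ} {T : G.Colouring} (e : G.Edge) : Propagates S n T →
      (T.Rule0 e ∨ T.Rule2 e) → T.Red e → Propagates S n (T.colour {e})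

/-- The rules have been applied exhaustively. -/
def Exhausted : Prop :=
  (∀ e, S.Rule0 e → e ∈ S.green) ∧ (∀ d, S.Rule1 d → rule1Pieces d ⊆ S.green) ∧
    (∀ e, S.Rule2 e → e ∈ S.green)

/-- One step of the construction: colour an orange enclosing piece green, which makes the unknown
end of its edge a new initial value, and then propagate exhaustively. The number `n` counts the
orange curves that Rule 0 or 2 colours during the propagation. -/
def Advance (n : ℕ) (T : G.Colouring) : Prop :=
  ∃ d : D, G.tail d ∈ S.known ∧ G.head d ∉ S.known ∧ S.Orange (G.edge d) ∧
    Propagates ⟨insert (G.head d) S.init, insert (G.edge d) S.green⟩ n T ∧ T.Exhausted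

/-! ### Entanglement -/

/-- At the quad to the left of `d`, the curve through `d` changes from green to red, and it leaves
the known subgraph through a pair of red enclosing pieces, those that cross `next d` and
`next (next (next d))`. -/
def Exit (d : D) : Prop :=
  G.face d ∉ G.hole ∧ G.edge d ∈ S.green ∧ S.Red (G.edge (G.next (G.next d))) ∧
    (S.Red (G.edge (G.next d)) ∧ S.Enclosing (G.edge (G.next d))) ∧
    (S.Red (G.edge (G.next (G.next (G.next d)))) ∧
      S.Enclosing (G.edge (G.next (G.next (G.next d)))))

/-- Consecutive red pieces of a curve. -/
def RedStep (e e' : G.Edge) : Prop := S.Red e ∧ S.Red e' ∧ G.Opposite e e'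

/-- Tracking the curve that contains the pair of pieces at the exit `d`, starting from this pair
and running over red pieces, one arrives at the known subgraph at the exit `d'`. -/
def TracksTo (d d' : D) : Prop :=
  S.Exit d ∧ S.Exit d' ∧
    (Relation.ReflTransGen S.RedStep (G.edge (G.next d)) (G.edge (G.next (G.next d'))) ∨
      Relation.ReflTransGen S.RedStep (G.edge (G.next (G.next (G.next d))))
        (G.edge (G.next (G.next d'))))

/-- A set of curves leaving the known subgraph is entangled if it consists of the curves
`C 0, ..., C (j - 1)`, where `C i` contains the pair of pieces at the exit `p i`, tracking `C i`
from there leads to the exit `p (i + 1)`, and `p j = p 0`. -/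
def Entangled (C : Set G.Strip) : Prop :=
  ∃ (j : ℕ) (p : ℕ → D), 0 < j ∧ p j = p 0 ∧ (∀ i < j, S.TracksTo (p i) (p (i + 1))) ∧
    C = {c | ∃ i < j, c = G.strip (G.edge (G.next (p i)))}

end Colouring

/-- A run of the colouring procedure with `m` colouring steps. The colouring `state i` describes the
subgraph obtained after `i + 1` initial values have been chosen, and `uses i` is the number of
orange curves coloured by Rule 0 or 2 in the propagation that leads to `state (i + 1)`. -/
structure Run (m : ℕ) where
  state : Fin (m + 1) → G.Colouring
  uses : Fin m → ℕ
  start : ∃ x : G.Vertex, state 0 = ⟨{x}, ∅⟩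
  advance : ∀ i : Fin m, (state i.castSucc).Advance (uses i) (state i.succ)

/-! ### Quad relations and initial value problems -/

variable (k : Type*) [Field k]

/-- The four corners of a quad, in cyclic order from an arbitrary first one. -/
noncomputable def corner (q : G.Quad) (i : Fin 4) : G.Vertex :=
  G.tail ((G.next ^ (i : ℕ)) (Quotient.out q.1))

variable {k}

/-- The multi-affine polynomial with coefficients `c (q, ·)` in the values of `u` at the corners
of the quad `q`. -/
noncomputable def quadRelation (c : G.Quad × Finset (Fin 4) → k) (q : G.Quad) (u : G.Vertex → k) :
    k :=
  ∑ A : Finset (Fin 4), c (q, A) * ∏ i ∈ A, u (G.corner q i)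

/-- The imposed relation is satisfied at every quad. -/
def IsSolution (c : G.Quad × Finset (Fin 4) → k) (u : G.Vertex → k) : Prop :=
  ∀ q, G.quadRelation c q u = 0

/-- The IVP that prescribes the values on `I` is well-posed for the relations with coefficients `c`:
for generic initial values there is exactly one solution. -/
def WellPosed (c : G.Quad × Finset (Fin 4) → k) (I : Set G.Vertex) : Prop :=
  ∃ R : MvPolynomial I k, R ≠ 0 ∧ ∀ w : I → k, MvPolynomial.eval w R ≠ 0 →
    ∃! u : G.Vertex → k, G.IsSolution c u ∧ ∀ x : I, u x = w x

variable (k)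

/-- The IVP on `I` is well-posed for generic multi-affine quad relations over `k`. -/
def GenericallyWellPosed (I : Set G.Vertex) : Prop :=
  ∃ P : MvPolynomial (G.Quad × Finset (Fin 4)) k, P ≠ 0 ∧
    ∀ c : G.Quad × Finset (Fin 4) → k, MvPolynomial.eval c P ≠ 0 → G.WellPosed c I

end QuadGraph

/-! Three facts combine. First, every step of the procedure starts one new curve by its enclosing
piece, and Rules 0 and 2 start `h` more, so after `s - h` steps all `s` curves have a green piece
(`Run.greenStrips_last`). A piece left over would then be red. Following its curve to the first
green piece gives an exit, and the pair there again consists of red pieces; since there are finitely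
many exits, this walk from exit to exit eventually cycles, which is an entanglement. So everything
is green and every vertex is known (`Colouring.green_eq_univ`).

Secondly, only Rule 1 makes non-initial vertices known, and it does so as the fourth corner of a
quad with three known corners (`Ranked`). Sending a vertex to such a quad is injective, since the
vertex is the strictly last corner. Euler's formula, with at least two ends at holes for each strip,
gives at least as many non-initial vertices as quads (`card_quad_add_le`). Hence the map is a
bijection, and each relation determines exactly one vertex.

Thirdly, such a triangular multi-affine system is solved by division. At the specialization where
each relation reads `u = 0` for its last vertex all divisors equal 1, so none vanishes identically
(`exists_unique_solution_of_triangular`). -/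

theorem Function.Involutive.even_natCard {X : Type*} [Finite X] {f : X → X}
    (hf : Function.Involutive f) (hne : ∀ x, f x ≠ x) : Even (Nat.card X) := by
  classical
  have := Fintype.ofFinite X
  rw [Nat.card_eq_fintype_card, ← ZMod.natCast_eq_zero_iff_even]
  have h : ∑ _x : X, (1 : ZMod 2) = 0 :=
    Finset.sum_involution (fun x _ => f x) (fun _ _ => by decide) (fun x _ _ => hne x)
      (fun _ _ => Finset.mem_univ _) (fun x _ => hf x)
  simpa using h

theorem Nat.card_eq_sum_card_fiber {X Y : Type*} [Finite X] [Fintype Y] (f : X → Y) :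
    Nat.card X = ∑ y, Nat.card {x // f x = y} := by
  rw [← Nat.card_congr (Equiv.sigmaFiberEquiv f), Nat.card_sigma]

/-! ### Darts, edges and faces of combinatorial maps -/

namespace CombMap

variable {D : Type*} (M : CombMap D)

theorem tail_next (d : D) : M.tail (M.next d) = M.head d := by
  refine (Quotient.sound (s := Equiv.Perm.SameCycle.setoid M.rot) ?_).symm
  refine ⟨1, ?_⟩
  simp [rot, M.rev_rev]

theorem face_eq_iff {d d' : D} : M.face d = M.face d' ↔ M.next.SameCycle d d' :=
  Quotient.eq (r := Equiv.Perm.SameCycle.setoid M.next)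

theorem face_next (d : D) : M.face (M.next d) = M.face d :=
  M.face_eq_iff.2 ⟨-1, by simp⟩

theorem edge_eq_iff {d d' : D} : M.edge d = M.edge d' ↔ d' = d ∨ d' = M.rev d := by
  have h : M.edge d = M.edge d' ↔ M.rev.SameCycle d d' :=
    Quotient.eq (r := Equiv.Perm.SameCycle.setoid M.rev)
  rw [h]
  constructor
  · rintro ⟨i, rfl⟩
    have h2 : M.rev ^ (2 : ℤ) = 1 := by
      ext d; exact M.rev_rev d
    rcases Int.even_or_odd' i with ⟨j, rfl | rfl⟩
    · left; simp [zpow_mul, h2]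
    · right; simp [zpow_add, zpow_mul, h2]
  · rintro (rfl | rfl)
    · exact ⟨0, by simp⟩
    · exact ⟨1, by simp⟩

theorem edge_rev (d : D) : M.edge (M.rev d) = M.edge d :=
  M.edge_eq_iff.2 (Or.inr (M.rev_rev d).symm)

theorem edge_surjective (e : M.Edge) : ∃ d, M.edge d = e := Quotient.exists_rep e

theorem face_surjective (f : M.Face) : ∃ d, M.face d = f := Quotient.exists_rep f

theorem tail_surjective (x : M.Vertex) : ∃ d, M.tail d = x := Quotient.exists_rep x

instance [Finite D] : Finite M.Vertex := Quotient.finite _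

instance [Finite D] : Finite M.Edge := Quotient.finite _

instance [Finite D] : Finite M.Face := Quotient.finite _

theorem faceDegree_face [Finite D] (d : D) :
    M.faceDegree (M.face d) = Function.minimalPeriod M.next d := by
  classical
  have := Fintype.ofFinite D
  have h := MulAction.minimalPeriod_eq_card (a := M.next) (b := d)
  rw [← Nat.card_eq_fintype_card] at h
  refine Eq.trans (Nat.card_congr (Equiv.subtypeEquivRight fun d' => ?_)) h.symm
  rw [eq_comm, face_eq_iff]
  constructor
  · rintro ⟨i, hi⟩
    exact ⟨⟨M.next ^ i, i, rfl⟩, hi⟩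
  · rintro ⟨⟨_, i, rfl⟩, hi⟩
    exact ⟨i, hi⟩

end CombMap

/-! ### Quads, strips and Euler's formula -/

namespace QuadGraph

variable {D : Type*} (G : QuadGraph D)

instance [Finite D] : Finite G.Quad := Subtype.finite

instance [Finite D] : Finite G.Strip := Quotient.finite _

section

variable [Finite D]

theorem minimalPeriod_next {d : D} (hd : G.face d ∉ G.hole) :
    Function.minimalPeriod G.next d = 4 := by
  rw [← G.faceDegree_face, G.quad_degree _ hd]

theorem next_four {d : D} (hd : G.face d ∉ G.hole) :
    G.next (G.next (G.next (G.next d))) = d := by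
  have h := Function.isPeriodicPt_minimalPeriod G.next d
  rw [G.minimalPeriod_next hd] at h
  exact h

theorem next_next_ne {d : D} (hd : G.face d ∉ G.hole) : G.next (G.next d) ≠ d := by
  intro h
  have h2 : Function.IsPeriodicPt G.next 2 d := h
  have := h2.minimalPeriod_le (by norm_num)
  rw [G.minimalPeriod_next hd] at this
  omega

theorem next_ne (d : D) : G.next d ≠ d := by
  intro h
  have h1 : Function.IsPeriodicPt G.next 1 d := h
  have := h1.minimalPeriod_le one_pos
  rw [← G.faceDegree_face] at this
  by_cases hd : G.face d ∈ G.hole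
  · have := G.hole_degree _ hd; omega
  · have := G.quad_degree _ hd; omega

theorem eq_next_of_face_eq {d d' : D} (hd : G.face d ∉ G.hole) (h : G.face d' = G.face d) :
    d' = d ∨ d' = G.next d ∨ d' = G.next (G.next d) ∨ d' = G.next (G.next (G.next d)) := by
  obtain ⟨i, rfl⟩ := (G.face_eq_iff.1 h.symm).exists_nat_pow_eq
  rw [Equiv.Perm.coe_pow] at *
  rw [← Function.iterate_mod_minimalPeriod_eq, G.minimalPeriod_next hd]
  have : i % 4 < 4 := Nat.mod_lt _ (by norm_num)
  interval_cases i % 4 <;> simp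

theorem Opposite.symm {e e' : G.Edge} (h : G.Opposite e e') : G.Opposite e' e := by
  obtain ⟨d, hd, rfl, rfl⟩ := h
  exact ⟨G.next (G.next d), by simpa [G.face_next] using hd, rfl, by rw [G.next_four hd]⟩

theorem strip_eq_iff {e e' : G.Edge} :
    G.strip e = G.strip e' ↔ Relation.ReflTransGen G.Opposite e e' := by
  have : Std.Symm G.Opposite := ⟨fun _ _ h => Opposite.symm G h⟩
  rw [← Relation.EqvGen.eqvGen_eq_reflTransGen]
  exact Quotient.eq (r := Relation.EqvGen.setoid G.Opposite)

theorem Opposite.strip_eq {e e' : G.Edge} (h : G.Opposite e e') : G.strip e = G.strip e' :=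
  G.strip_eq_iff.2 (Relation.ReflTransGen.single h)

theorem strip_next_next {d : D} (hd : G.face d ∉ G.hole) :
    G.strip (G.edge (G.next (G.next d))) = G.strip (G.edge d) :=
  (Opposite.strip_eq G ⟨d, hd, rfl, rfl⟩).symm

/-- Consecutive darts of a hole lie on different edges. -/
theorem edge_next_ne {d : D} (hd : G.face d ∈ G.hole) : G.edge (G.next d) ≠ G.edge d := by
  intro h
  rcases G.edge_eq_iff.1 h.symm with h | h
  · exact G.next_ne d h
  · refine G.hole_edge d ⟨hd, ?_⟩
    rw [← h, G.face_next]
    exact hd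

/-! ### Counting vertices and quads -/

theorem two_mul_card_edge : 2 * Nat.card G.Edge = Nat.card D := by
  have := Fintype.ofFinite G.Edge
  rw [Nat.card_eq_sum_card_fiber G.edge, Finset.sum_congr rfl (g := fun _ => 2)]
  · simp [mul_comm]
  intro e _
  obtain ⟨d, rfl⟩ := G.edge_surjective e
  have : {d' | G.edge d' = G.edge d} = {d, G.rev d} := by
    ext d'
    rw [Set.mem_ofPred_eq, eq_comm, G.edge_eq_iff]
    simp
  rw [← Set.ncard_pair (G.rev_ne d).symm, ← this]
  rfl

theorem card_dart : Nat.card D = 4 * Nat.card G.Quad + Nat.card {d // G.face d ∈ G.hole} := by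
  classical
  have := Fintype.ofFinite G.Quad
  rw [← Nat.card_congr (Equiv.sumCompl fun d => G.face d ∈ G.hole), Nat.card_sum, add_comm]
  congr 1
  rw [Nat.card_eq_sum_card_fiber
    (Y := G.Quad) (fun d : {d // G.face d ∉ G.hole} => ⟨G.face d, d.2⟩),
    Finset.sum_congr rfl (g := fun _ => 4)]
  · simp [mul_comm]
  intro q _
  rw [← G.quad_degree q.1 q.2]
  refine Nat.card_congr ⟨fun d => ⟨d.1, congrArg Subtype.val d.2⟩,
    fun d => ⟨⟨d.1, by rw [d.2]; exact q.2⟩, Subtype.ext d.2⟩, fun _ => rfl, fun _ => rfl⟩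

/-- Reversal pairs off all darts of the strip, and passing to the opposite side pairs off those on
quads; the remaining ones lie at holes. -/
theorem even_card_strip_hole (C : G.Strip) :
    Even (Nat.card {d // G.strip (G.edge d) = C ∧ G.face d ∈ G.hole}) := by
  classical
  have h1 : Even (Nat.card {d // G.strip (G.edge d) = C}) :=
    Function.Involutive.even_natCard
      (f := fun d => ⟨G.rev d, by rw [G.edge_rev]; exact d.2⟩)
      (fun d => Subtype.ext (G.rev_rev d)) (fun d h => G.rev_ne d (congrArg Subtype.val h))
  have h2 : Even (Nat.card {d // G.strip (G.edge d) = C ∧ G.face d ∉ G.hole}) :=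
    Function.Involutive.even_natCard
      (f := fun d => ⟨G.next (G.next d), by
        rw [G.strip_next_next d.2.2, G.face_next, G.face_next]; exact d.2⟩)
      (fun d => Subtype.ext (G.next_four d.2.2))
      (fun d h => G.next_next_ne d.2.2 (congrArg Subtype.val h))
  have h3 := Nat.card_congr
    (Equiv.sumCompl fun d : {d // G.strip (G.edge d) = C} => G.face d ∈ G.hole)
  rw [Nat.card_sum,
    Nat.card_congr (Equiv.subtypeSubtypeEquivSubtypeInter (fun d => G.strip (G.edge d) = C)
      (fun d => G.face d ∈ G.hole)),
    Nat.card_congr (Equiv.subtypeSubtypeEquivSubtypeInter (fun d => G.strip (G.edge d) = C)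
      (fun d => G.face d ∉ G.hole))] at h3
  rw [← h3, Nat.even_add] at h1
  exact h1.2 h2

theorem two_mul_numStrips_le (hclosed : ∀ C : G.Strip, ¬ G.ClosedStrip C) :
    2 * G.numStrips ≤ Nat.card {d // G.face d ∈ G.hole} := by
  have := Fintype.ofFinite G.Strip
  rw [Nat.card_eq_sum_card_fiber
    (fun d : {d // G.face d ∈ G.hole} => G.strip (G.edge d))]
  have h := Finset.card_nsmul_le_sum Finset.univ
    (fun C => Nat.card {d : {d // G.face d ∈ G.hole} // G.strip (G.edge d) = C}) 2 ?_
  · simpa [numStrips, mul_comm] using h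
  intro C _
  have he := G.even_card_strip_hole C
  obtain ⟨d, hd⟩ := not_forall.1 (hclosed C)
  rw [Classical.not_imp, not_not] at hd
  have : Nonempty {d // G.strip (G.edge d) = C ∧ G.face d ∈ G.hole} := ⟨⟨d, hd⟩⟩
  have hpos : 0 < Nat.card {d // G.strip (G.edge d) = C ∧ G.face d ∈ G.hole} := Nat.card_pos
  have hcongr := Nat.card_congr
    (Equiv.subtypeSubtypeEquivSubtypeInter (fun d => G.face d ∈ G.hole)
      (fun d => G.strip (G.edge d) = C))
  simp only [and_comm (a := G.face _ ∈ G.hole)] at hcongr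
  rw [hcongr]
  obtain ⟨n, hn⟩ := he
  omega

theorem card_face : Nat.card G.Face = Nat.card G.Quad + G.numInnerHoles + 1 := by
  classical
  rw [← Nat.card_congr (Equiv.sumCompl fun f => f ∈ G.hole), Nat.card_sum, add_comm, add_assoc]
  congr 1
  rw [Nat.card_coe_set_eq, ← Set.ncard_sdiff_singleton_add_one G.outer_hole (Set.toFinite _)]
  rfl

/-- Without closed strips, there are as many initial values as the vertices exceed the quads. -/
theorem card_quad_add_le (hclosed : ∀ C : G.Strip, ¬ G.ClosedStrip C) {m : ℕ}
    (hm : m + G.numInnerHoles = G.numStrips) :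
    Nat.card G.Quad + (m + 1) ≤ Nat.card G.Vertex := by
  have h1 := G.two_mul_card_edge
  have h2 := G.card_dart
  have h3 := G.two_mul_numStrips_le hclosed
  have h4 := G.card_face
  have h5 : (Nat.card G.Vertex : ℤ) - Nat.card G.Edge + Nat.card G.Face = 2 := G.planar
  -- With `H` darts at holes, `2E = 4Q + H` and `H ≥ 2s`, so `V = 2 + E - F = 1 + E - Q - h ≥ Q + s
  -- - h + 1`.
  omega

end

end QuadGraph

/-! ### The order in which vertices become known -/

namespace QuadGraph

variable {D : Type*} (G : QuadGraph D)

/-- Every vertex of `K` is an element of `I` or a corner of a quad whose other corners lie in `K`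
and precede it with respect to a rank function. -/
def Ranked (I K : Set G.Vertex) : Prop :=
  ∃ ρ : G.Vertex → ℕ, ∀ x ∈ K, x ∈ I ∨ ∃ d, G.tail d = x ∧ G.face d ∉ G.hole ∧
    ∀ d', G.face d' = G.face d → d' ≠ d → G.tail d' ∈ K ∧ ρ (G.tail d') < ρ x

variable {G}

theorem Ranked.insert_init {I K : Set G.Vertex} (h : G.Ranked I K) (x : G.Vertex) :
    G.Ranked (insert x I) (insert x K) := by
  obtain ⟨ρ, h⟩ := h
  refine ⟨ρ, ?_⟩
  rintro y (rfl | hy)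
  · exact Or.inl (Set.mem_insert _ _)
  · rcases h y hy with hI | ⟨d, hd, hq, h⟩
    · exact Or.inl (Set.mem_insert_of_mem _ hI)
    · exact Or.inr ⟨d, hd, hq, fun d' h1 h2 => ⟨Set.mem_insert_of_mem _ (h d' h1 h2).1,
        (h d' h1 h2).2⟩⟩

theorem Ranked.insert_corner [Finite D] {I K : Set G.Vertex} (h : G.Ranked I K) (d : D)
    (hd : G.face d ∉ G.hole) (hK : ∀ d', G.face d' = G.face d → d' ≠ d → G.tail d' ∈ K) :
    G.Ranked I (insert (G.tail d) K) := by
  classical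
  by_cases hx : G.tail d ∈ K
  · rwa [Set.insert_eq_of_mem hx]
  have := Fintype.ofFinite G.Vertex
  obtain ⟨ρ, h⟩ := h
  have hne : ∀ y ∈ K, y ≠ G.tail d := fun y hy hyx => hx (hyx ▸ hy)
  -- One more than the sum of all old ranks exceeds each of them. The vertex is new to `K`, so no
  -- rank used earlier changes.
  refine ⟨Function.update ρ (G.tail d) (∑ y, ρ y + 1), ?_⟩
  rintro y (rfl | hy)
  · refine Or.inr ⟨d, rfl, hd, fun d' h1 h2 => ⟨Set.mem_insert_of_mem _ (hK d' h1 h2), ?_⟩⟩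
    rw [Function.update_self, Function.update_of_ne (hne _ (hK d' h1 h2)), Nat.lt_succ_iff]
    exact Finset.single_le_sum (f := ρ) (fun _ _ => Nat.zero_le _) (Finset.mem_univ _)
  · refine (h y hy).imp_right fun ⟨d', hd', hq, h⟩ => ⟨d', hd', hq, fun d'' h1 h2 => ?_⟩
    obtain ⟨h3, h4⟩ := h d'' h1 h2
    refine ⟨Set.mem_insert_of_mem _ h3, ?_⟩
    rwa [Function.update_of_ne (hne _ h3), Function.update_of_ne (hne _ hy)]

/-! ### Effect of the rules on known vertices and green strips -/

namespace Colouring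

variable (S : G.Colouring)

theorem tail_mem_known {S : G.Colouring} {d : D} (h : G.edge d ∈ S.green) : G.tail d ∈ S.known :=
  Or.inr ⟨d, h, rfl⟩

theorem head_mem_known {S : G.Colouring} {d : D} (h : G.edge d ∈ S.green) : G.head d ∈ S.known :=
  Or.inr ⟨G.rev d, by rwa [G.edge_rev], rfl⟩

/-- The vertices that become known with further green pieces. -/
theorem known_union_green (I : Set G.Vertex) (A B : Set G.Edge) :
    (⟨I, A ∪ B⟩ : G.Colouring).known =
      (⟨I, A⟩ : G.Colouring).known ∪ {x | ∃ d, G.edge d ∈ B ∧ G.tail d = x} := by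
  ext x
  constructor
  · rintro (h | ⟨d, h | h, rfl⟩)
    · exact Or.inl (Or.inl h)
    · exact Or.inl (Or.inr ⟨d, h, rfl⟩)
    · exact Or.inr ⟨d, h, rfl⟩
  · rintro ((h | ⟨d, h, rfl⟩) | ⟨d, h, rfl⟩)
    · exact Or.inl h
    · exact Or.inr ⟨d, Or.inl h, rfl⟩
    · exact Or.inr ⟨d, Or.inr h, rfl⟩

theorem known_colour_singleton {S : G.Colouring} {d : D} (h1 : G.tail d ∈ S.known)
    (h2 : G.head d ∈ S.known) : (S.colour {G.edge d}).known = S.known := by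
  rw [colour, known_union_green, Set.union_eq_left]
  rintro _ ⟨d', h, rfl⟩
  rcases G.edge_eq_iff.1 (Eq.symm h) with rfl | rfl
  · exact h1
  · exact h2

section

variable [Finite D] {S}

theorem Rule1.known_eq {d : D} (h : S.Rule1 d) :
    (S.colour (rule1Pieces d)).known = insert (G.tail (G.next (G.next (G.next d)))) S.known := by
  obtain ⟨hd, h1, h2⟩ := h
  have hx2 : G.tail (G.next (G.next d)) ∈ S.known := by
    rw [G.tail_next]; exact head_mem_known h2
  have hx0 : G.head (G.next (G.next (G.next d))) ∈ S.known := by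
    rw [← G.tail_next, G.next_four hd]; exact tail_mem_known h1
  rw [colour, known_union_green, Set.insert_eq, Set.union_comm]
  apply Set.Subset.antisymm
  · rintro x (⟨d', h | h, rfl⟩ | h)
    · rcases G.edge_eq_iff.1 h.symm with rfl | rfl
      · exact Or.inr hx2
      · exact Or.inl (G.tail_next _).symm
    · rcases G.edge_eq_iff.1 (Eq.symm h) with rfl | rfl
      · exact Or.inl rfl
      · exact Or.inr hx0
    · exact Or.inr h
  · rintro x (rfl | h)
    · exact Or.inl ⟨_, Or.inr rfl, rfl⟩
    · exact Or.inr h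

theorem Rule1.ranked {d : D} (h : S.Rule1 d) (hS : G.Ranked S.init S.known) :
    G.Ranked S.init (S.colour (rule1Pieces d)).known := by
  rw [h.known_eq]
  obtain ⟨hd, h1, h2⟩ := h
  refine hS.insert_corner _ (by simpa only [G.face_next] using hd) fun d' h3 h4 => ?_
  simp only [G.face_next] at h3
  rcases G.eq_next_of_face_eq hd h3 with rfl | rfl | rfl | rfl
  · exact tail_mem_known h1
  · exact tail_mem_known h2
  · rw [G.tail_next]; exact head_mem_known h2
  · exact absurd rfl h4

/-- Rules 0 and 2 do not determine new vertices. -/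
theorem known_colour_of_rule02 {e : G.Edge} (h : S.Rule0 e ∨ S.Rule2 e) :
    (S.colour {e}).known = S.known := by
  rcases h with ⟨d, rfl, h1, h2⟩ | ⟨d, rfl, hd, h⟩
  · exact known_colour_singleton h1 h2
  -- The two neighbouring edges on the boundary of the hole are distinct from this one, hence green,
  -- and they contain its ends.
  · apply known_colour_singleton
    · obtain ⟨d', rfl⟩ := G.next.surjective d
      rw [G.face_next] at hd
      rw [G.tail_next]
      exact head_mem_known (h d' (G.face_next d').symm (G.edge_next_ne hd).symm)
    · rw [← G.tail_next]
      exact tail_mem_known (h _ (G.face_next d) (G.edge_next_ne hd))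

end

/-- The strips that have a green piece. -/
def greenStrips : Set G.Strip := G.strip '' S.green

variable {S}

theorem greenStrips_colour (P : Set G.Edge) :
    (S.colour P).greenStrips = S.greenStrips ∪ G.strip '' P :=
  Set.image_union ..

theorem Orange.strip_notMem {e : G.Edge} (h : S.Orange e) : G.strip e ∉ S.greenStrips := by
  rintro ⟨e', h1, h2⟩
  exact h e' h2 h1

theorem Red.strip_mem {e : G.Edge} (h : S.Red e) : G.strip e ∈ S.greenStrips := by
  obtain ⟨-, e', h1, h2⟩ := h
  exact ⟨e', h1, h2⟩

section

variable [Finite D]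

theorem Rule1.greenStrips_eq {d : D} (h : S.Rule1 d) :
    (S.colour (rule1Pieces d)).greenStrips = S.greenStrips := by
  obtain ⟨hd, h1, h2⟩ := h
  rw [greenStrips_colour, Set.union_eq_left]
  rintro _ ⟨e, rfl | rfl, rfl⟩
  · rw [G.strip_next_next hd]
    exact ⟨_, h1, rfl⟩
  · rw [G.strip_next_next (by rwa [G.face_next])]
    exact ⟨_, h2, rfl⟩

/-- Rule 1 adds at most one vertex, the last corner of its quad, and starts no curve. Rules 0 and 2
add no vertex and start a curve exactly when the piece is orange. -/
theorem Propagates.invariants {n : ℕ} {T : G.Colouring} (h : Propagates S n T)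
    (hS : G.Ranked S.init S.known) :
    T.init = S.init ∧ G.Ranked T.init T.known ∧
      T.greenStrips.ncard = S.greenStrips.ncard + n := by
  induction h with
  | refl => exact ⟨rfl, hS, rfl⟩
  | rule1 d _ h ih =>
    refine ⟨ih.1, h.ranked ih.2.1, ?_⟩
    rw [h.greenStrips_eq, ih.2.2]
  | rule02_orange e _ h ho ih =>
    refine ⟨ih.1, ?_, ?_⟩
    · rw [known_colour_of_rule02 h]
      exact ih.2.1
    · rw [greenStrips_colour, Set.image_singleton, Set.union_singleton,
        Set.ncard_insert_of_notMem ho.strip_notMem, ih.2.2, add_assoc]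
  | rule02_red e _ h hr ih =>
    refine ⟨ih.1, ?_, ?_⟩
    · rw [known_colour_of_rule02 h]
      exact ih.2.1
    · rw [greenStrips_colour, Set.image_singleton, Set.union_singleton,
        Set.insert_eq_of_mem hr.strip_mem, ih.2.2]

theorem Advance.invariants {n : ℕ} {T : G.Colouring} (h : S.Advance n T)
    (hS : G.Ranked S.init S.known) :
    T.init.ncard = S.init.ncard + 1 ∧ G.Ranked T.init T.known ∧
      T.greenStrips.ncard = S.greenStrips.ncard + 1 + n := by
  obtain ⟨d, h1, h2, ho, hp, -⟩ := h
  have hknown : (⟨insert (G.head d) S.init, insert (G.edge d) S.green⟩ : G.Colouring).known =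
      insert (G.head d) S.known := by
    rw [← Set.union_singleton (s := S.green), known_union_green]
    ext x
    constructor
    · rintro (((rfl | h) | h) | ⟨d', h, rfl⟩)
      · exact Or.inl rfl
      · exact Or.inr (Or.inl h)
      · exact Or.inr (Or.inr h)
      · rcases G.edge_eq_iff.1 (Eq.symm h) with rfl | rfl
        · exact Or.inr h1
        · exact Or.inl rfl
    · rintro (rfl | h | h)
      · exact Or.inl (Or.inl (Or.inl rfl))
      · exact Or.inl (Or.inl (Or.inr h))
      · exact Or.inl (Or.inr h)
  obtain ⟨h3, h4, h5⟩ := hp.invariants (by rw [hknown]; exact hS.insert_init _)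
  refine ⟨?_, h4, ?_⟩
  · rw [h3, Set.ncard_insert_of_notMem fun h => h2 (Or.inl h)]
  · rw [h5, greenStrips, Set.image_insert_eq]
    exact congrArg (· + n) (Set.ncard_insert_of_notMem ho.strip_notMem)

/-! ### Exits and entanglement -/

/-- A curve with a red piece runs over red pieces to an exit. -/
theorem exists_exit (hS : S.Exhausted) (hred : ∀ e, e ∉ S.green → S.Red e) {e : G.Edge}
    (he : S.Red e) :
    ∃ d, S.Exit d ∧ Relation.ReflTransGen S.RedStep e (G.edge (G.next (G.next d))) := by
  obtain ⟨-, e₀, h₀, hstrip⟩ := id he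
  have key : ∀ b, Relation.ReflTransGen G.Opposite e b →
      (b ∉ S.green ∧ Relation.ReflTransGen S.RedStep e b) ∨
        ∃ d, S.Exit d ∧ Relation.ReflTransGen S.RedStep e (G.edge (G.next (G.next d))) := by
    intro b hb
    induction hb with
    | refl => exact Or.inl ⟨he.1, Relation.ReflTransGen.refl⟩
    | @tail b c _ hbc ih =>
      refine ih.elim (fun ⟨hb, hb'⟩ => ?_) Or.inr
      by_cases hc : c ∈ S.green
      -- At the first green piece on the way, a green adjacent side would let Rule 1 colour the
      -- preceding piece. So both adjacent sides are red, and each shares an end with the green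
      -- edge; their other ends are unknown, since otherwise Rule 0 would colour them.
      · obtain ⟨d, hd, rfl, rfl⟩ := Opposite.symm G hbc
        refine Or.inr ⟨d, ⟨hd, hc, hred _ hb, ?_⟩, hb'⟩
        have h1 : G.edge (G.next d) ∉ S.green := fun h =>
          hb (hS.2.1 d ⟨hd, hc, h⟩ (Or.inl rfl))
        have h3 : G.edge (G.next (G.next (G.next d))) ∉ S.green := by
          intro h
          have := hS.2.1 (G.next (G.next (G.next d)))
            ⟨by simpa only [G.face_next] using hd, h, by rwa [G.next_four hd]⟩ (Or.inr rfl)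
          rw [G.next_four hd] at this
          exact hb this
        refine ⟨⟨hred _ h1, G.next d, rfl, ?_, fun h => h1 (hS.1 _ ⟨_, rfl, ?_, h⟩)⟩,
          hred _ h3, G.rev (G.next (G.next (G.next d))), G.edge_rev _, ?_,
          fun h => h3 (hS.1 _ ⟨_, G.edge_rev _, ?_, h⟩)⟩
        · rw [G.tail_next]; exact head_mem_known hc
        · rw [G.tail_next]; exact head_mem_known hc
        · change G.head _ ∈ _
          rw [← G.tail_next, G.next_four hd]; exact tail_mem_known hc
        · change G.head _ ∈ _
          rw [← G.tail_next, G.next_four hd]; exact tail_mem_known hc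
      · exact Or.inl ⟨hc, hb'.tail ⟨hred _ hb, hred _ hc, hbc⟩⟩
  exact (key e₀ (G.strip_eq_iff.1 hstrip.symm)).resolve_left fun h => h.1 h₀

/-- From the pair at an exit one can always track to another exit, so if one exit exists, iteration
on the finite set of exits produces a cycle. -/
theorem green_eq_univ (hS : S.Exhausted) (hred : ∀ e, e ∉ S.green → S.Red e)
    (hent : ∀ C : Set G.Strip, ¬ S.Entangled C) : S.green = Set.univ := by
  by_contra hne
  obtain ⟨e, he⟩ := (Set.ne_univ_iff_exists_notMem _).1 hne
  obtain ⟨d₀, hd₀, -⟩ := exists_exit hS hred (hred e he)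
  have hstep : ∀ x : {d // S.Exit d}, ∃ y : {d // S.Exit d}, S.TracksTo x y := by
    rintro ⟨d, hd⟩
    obtain ⟨d', hd', h⟩ := exists_exit hS hred hd.2.2.2.1.1
    exact ⟨⟨d', hd'⟩, hd, hd', Or.inl h⟩
  choose f hf using hstep
  obtain ⟨a, b, hab, h⟩ := Finite.exists_ne_map_eq_of_infinite fun n : ℕ => f^[n] ⟨d₀, hd₀⟩
  wlog hlt : a < b generalizing a b
  · exact this b a hab.symm h.symm (lt_of_le_of_ne (not_lt.1 hlt) hab.symm)
  refine hent _ ⟨b - a, fun i => (f^[a + i] ⟨d₀, hd₀⟩ : {d // S.Exit d}).1,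
    Nat.sub_pos_of_lt hlt, ?_, fun i _ => ?_, rfl⟩
  · dsimp only
    rw [Nat.add_sub_cancel' hlt.le, add_zero]
    exact congrArg Subtype.val h.symm
  · dsimp only
    rw [← add_assoc, Function.iterate_succ_apply']
    exact hf _

end

end Colouring

/-! ### Bookkeeping along a run -/

namespace Run

variable [Finite D] {m : ℕ} (r : G.Run m)

theorem invariants (i : Fin (m + 1)) :
    (r.state i).init.ncard = i + 1 ∧ G.Ranked (r.state i).init (r.state i).known ∧
      (r.state i).greenStrips.ncard =
        i + ∑ j ∈ Finset.univ.filter (fun j : Fin m => (j : ℕ) < i), r.uses j := by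
  induction i using Fin.induction with
  | zero =>
    obtain ⟨x, hx⟩ := r.start
    rw [hx]
    refine ⟨by simp, ⟨0, ?_⟩, by simp [Colouring.greenStrips]⟩
    rintro y (hy | ⟨d, hd, -⟩)
    · exact Or.inl hy
    · exact absurd hd (Set.notMem_empty _)
  | succ i ih =>
    obtain ⟨h1, h2, h3⟩ := (r.advance i).invariants ih.2.1
    refine ⟨by simp [h1, ih.1], h2, ?_⟩
    have : Finset.univ.filter (fun j : Fin m => (j : ℕ) < i.succ) =
        insert i (Finset.univ.filter (fun j : Fin m => (j : ℕ) < i.castSucc)) := by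
      ext j
      simp only [Finset.mem_filter_univ, Finset.mem_insert, Fin.ext_iff, Fin.val_succ,
        Fin.val_castSucc]
      omega
    rw [h3, ih.2.2, this, Finset.sum_insert (by simp)]
    simp only [Fin.val_castSucc, Fin.val_succ]
    ring

theorem greenStrips_last (hm : m + G.numInnerHoles = G.numStrips)
    (huses : ∑ i, r.uses i = G.numInnerHoles) :
    (r.state (Fin.last m)).greenStrips = Set.univ := by
  rw [Set.eq_univ_iff_ncard, (r.invariants _).2.2]
  simp only [Fin.val_last, Fin.is_lt, Finset.filter_true]
  rw [huses, hm]
  rfl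

theorem exhausted_last (hm : m + G.numInnerHoles = G.numStrips)
    (huses : ∑ i, r.uses i = G.numInnerHoles) : (r.state (Fin.last m)).Exhausted := by
  cases m with
  -- Without steps nothing was propagated, but this case is impossible: every strip would have a
  -- green piece, there is a dart on the outer face, and no piece is green at the start.
  | zero =>
    obtain ⟨d, -⟩ := G.face_surjective G.outer
    have h := r.greenStrips_last hm huses
    obtain ⟨x, hx⟩ := r.start
    obtain ⟨e, he, -⟩ : G.strip (G.edge d) ∈ (r.state 0).greenStrips := h ▸ Set.mem_univ _
    rw [hx] at he
    exact absurd he (Set.notMem_empty _)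
  | succ m =>
    obtain ⟨d, -, -, -, -, h⟩ := r.advance (Fin.last m)
    exact h

theorem known_last (hm : m + G.numInnerHoles = G.numStrips)
    (huses : ∑ i, r.uses i = G.numInnerHoles)
    (hent : ∀ C : Set G.Strip, ¬ (r.state (Fin.last m)).Entangled C) :
    (r.state (Fin.last m)).known = Set.univ := by
  have h := Colouring.green_eq_univ (r.exhausted_last hm huses) (fun e he => ⟨he, ?_⟩) hent
  · refine Set.eq_univ_of_forall fun x => ?_
    obtain ⟨d, rfl⟩ := G.tail_surjective x
    exact Colouring.tail_mem_known (h ▸ Set.mem_univ _)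
  · have : G.strip e ∈ (r.state (Fin.last m)).greenStrips :=
      r.greenStrips_last hm huses ▸ Set.mem_univ _
    exact this

end Run

end QuadGraph

/-! ### Rational functions regular at a point -/

namespace MvPolynomial

variable {σ k : Type*} [Field k]

/-- The functions that are given by a rational expression in the coordinates whose denominator
does not vanish at `p`, wherever the denominator does not vanish. -/
def rationalAt (p : σ → k) : Subring ((σ → k) → k) where
  carrier := {f | ∃ N D : MvPolynomial σ k, eval p D ≠ 0 ∧
    ∀ x, eval x D ≠ 0 → f x * eval x D = eval x N}
  mul_mem' := by
    rintro f g ⟨N, D, hD, h⟩ ⟨N', D', hD', h'⟩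
    refine ⟨N * N', D * D', by simpa using ⟨hD, hD'⟩, fun x hx => ?_⟩
    rw [map_mul, mul_ne_zero_iff] at hx
    rw [map_mul, map_mul, ← h x hx.1, ← h' x hx.2, Pi.mul_apply]
    ring
  one_mem' := ⟨1, 1, by simp, by simp⟩
  add_mem' := by
    rintro f g ⟨N, D, hD, h⟩ ⟨N', D', hD', h'⟩
    refine ⟨N * D' + N' * D, D * D', by simpa using ⟨hD, hD'⟩, fun x hx => ?_⟩
    rw [map_mul, mul_ne_zero_iff] at hx
    rw [map_mul, map_add, map_mul, map_mul, ← h x hx.1, ← h' x hx.2, Pi.add_apply]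
    ring
  zero_mem' := ⟨0, 1, by simp, by simp⟩
  neg_mem' := by
    rintro f ⟨N, D, hD, h⟩
    exact ⟨-N, D, hD, fun x hx => by simp [← h x hx]⟩

theorem coordinate_mem_rationalAt (p : σ → k) (i : σ) : (fun x => x i) ∈ rationalAt p :=
  ⟨X i, 1, by simp, by simp⟩

theorem inv_mem_rationalAt {p : σ → k} {f : (σ → k) → k} (hf : f ∈ rationalAt p)
    (hp : f p ≠ 0) : f⁻¹ ∈ rationalAt p := by
  obtain ⟨N, D, hD, h⟩ := hf
  -- The extra factor `D` makes the new denominator vanish wherever the old one does, where nothing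
  -- is known about `f`.
  refine ⟨D * D, N * D, ?_, fun x hx => ?_⟩
  · rw [map_mul, ← h p hD]
    exact mul_ne_zero (mul_ne_zero hp hD) hD
  · rw [map_mul, mul_ne_zero_iff] at hx
    have hfx : f x ≠ 0 := fun h0 => hx.1 (by rw [← h x hx.2, h0, zero_mul])
    rw [map_mul, map_mul, ← h x hx.2, Pi.inv_apply]
    field_simp

/-- A rational expression that does not vanish at `p` is generically nonzero. -/
theorem exists_eval_ne_zero_of_mem_rationalAt {p : σ → k} {f : (σ → k) → k}
    (hf : f ∈ rationalAt p) (hp : f p ≠ 0) :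
    ∃ T : MvPolynomial σ k, eval p T ≠ 0 ∧ ∀ x, eval x T ≠ 0 → f x ≠ 0 := by
  obtain ⟨N, D, hD, h⟩ := hf
  refine ⟨N * D, ?_, fun x hx h0 => ?_⟩
  · rw [map_mul, ← h p hD]
    exact mul_ne_zero (mul_ne_zero hp hD) hD
  · rw [map_mul, mul_ne_zero_iff] at hx
    exact hx.1 (by rw [← h x hx.2, h0, zero_mul])

end MvPolynomial

/-! ### Multi-affine polynomials and triangular systems -/

namespace MultiAffine

variable {k R : Type*} [Field k] [CommRing R] {ι : Type*} [Fintype ι] [DecidableEq ι]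

/-- The coefficient of the `t`-th variable in a multi-affine polynomial. -/
def lead (c : Finset ι → R) (t : ι) (v : ι → R) : R :=
  ∑ A ∈ Finset.univ.filter (t ∈ ·), c A * ∏ i ∈ A.erase t, v i

/-- The part of a multi-affine polynomial that does not contain the `t`-th variable. -/
def rest (c : Finset ι → R) (t : ι) (v : ι → R) : R :=
  ∑ A ∈ Finset.univ.filter (t ∉ ·), c A * ∏ i ∈ A, v i

theorem sum_eq_lead_add_rest (c : Finset ι → R) (t : ι) (v : ι → R) :
    ∑ A : Finset ι, c A * ∏ i ∈ A, v i = v t * lead c t v + rest c t v := by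
  rw [← Finset.sum_filter_add_sum_filter_not _ (t ∈ ·), lead, rest, Finset.mul_sum]
  congr 1
  refine Finset.sum_congr rfl fun A hA => ?_
  rw [← Finset.mul_prod_erase A v (Finset.mem_filter.1 hA).2]
  ring

theorem lead_congr (c : Finset ι → R) {t : ι} {v w : ι → R} (h : ∀ i, i ≠ t → v i = w i) :
    lead c t v = lead c t w :=
  Finset.sum_congr rfl fun _ _ => congrArg _ <|
    Finset.prod_congr rfl fun i hi => h i (Finset.ne_of_mem_erase hi)

theorem rest_congr (c : Finset ι → R) {t : ι} {v w : ι → R} (h : ∀ i, i ≠ t → v i = w i) :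
    rest c t v = rest c t w :=
  Finset.sum_congr rfl fun _ hA => congrArg _ <|
    Finset.prod_congr rfl fun i hi => h i fun hit => (Finset.mem_filter.1 hA).2 (hit ▸ hi)

theorem lead_indicator (t : ι) (v : ι → R) :
    lead (fun A => if A = {t} then 1 else 0) t v = 1 := by
  rw [lead, Finset.sum_eq_single {t}]
  · simp
  · intro A _ hA
    simp [hA]
  · simp

theorem lead_mem {S : Subring R} {c : Finset ι → R} {t : ι} {v : ι → R}
    (hc : ∀ A, c A ∈ S) (hv : ∀ i, i ≠ t → v i ∈ S) : lead c t v ∈ S :=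
  sum_mem fun A _ => mul_mem (hc A) (prod_mem fun i hi => hv i (Finset.ne_of_mem_erase hi))

theorem rest_mem {S : Subring R} {c : Finset ι → R} {t : ι} {v : ι → R}
    (hc : ∀ A, c A ∈ S) (hv : ∀ i, i ≠ t → v i ∈ S) : rest c t v ∈ S :=
  sum_mem fun _ hA => mul_mem (hc _) <| prod_mem fun i hi =>
    hv i fun hit => (Finset.mem_filter.1 hA).2 (hit ▸ hi)

theorem lead_apply {X : Type*} (c : Finset ι → X → k) (t : ι) (v : ι → X → k) (x : X) :
    lead c t v x = lead (fun A => c A x) t (fun i => v i x) := by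
  simp [lead]

theorem rest_apply {X : Type*} (c : Finset ι → X → k) (t : ι) (v : ι → X → k) (x : X) :
    rest c t v x = rest (fun A => c A x) t (fun i => v i x) := by
  simp [rest]

end MultiAffine

open MvPolynomial MultiAffine in
/-- A system of multi-affine equations that determines the unknowns one after the other is uniquely
solvable for generic coefficients and generic initial values. -/
theorem exists_unique_solution_of_triangular {V Q ι k : Type*} [Finite Q] [Fintype ι] [Field k]
    (I : Set V) (corner : Q → ι → V) (t : Q → ι) (ρ : V → ℕ)
    (hρ : ∀ q i, i ≠ t q → ρ (corner q i) < ρ (corner q (t q)))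
    (e : {x // x ∉ I} ≃ Q) (he : ∀ x, corner (e x) (t (e x)) = x) :
    ∃ P : MvPolynomial (Q × Finset ι) k, P ≠ 0 ∧ ∀ c, eval c P ≠ 0 →
      ∃ R : MvPolynomial I k, R ≠ 0 ∧ ∀ w, eval w R ≠ 0 →
        ∃! u : V → k, (∀ q, ∑ A : Finset ι, c (q, A) * ∏ i ∈ A, u (corner q i) = 0) ∧
          ∀ x : I, u x = w x := by
  classical
  have := Fintype.ofFinite Q
  let σ := (Q × Finset ι) ⊕ I
  let coef : Q → Finset ι → (σ → k) → k := fun q A p => p (Sum.inl (q, A))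
  -- At this point the relation of each quad becomes the vanishing of its last variable, with
  -- leading coefficient 1.
  let p₀ : σ → k := Sum.elim (fun a => if a.2 = {t a.1} then 1 else 0) (fun _ => 0)
  -- the values at the vertices as functions of the coefficients and the initial values
  let F : (x : V) → ((y : V) → ρ y < ρ x → (σ → k) → k) → (σ → k) → k := fun x U =>
    if hx : x ∈ I then fun p => p (Sum.inr ⟨x, hx⟩) else
      let q := e ⟨x, hx⟩
      -- The default 0 is only taken at the variable being solved for, on which `lead` and `rest` do
      -- not depend.
      let v : ι → (σ → k) → k := fun i =>
        if h : ρ (corner q i) < ρ x then U (corner q i) h else 0;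
      (-rest (coef q) (t q) v) * (lead (coef q) (t q) v)⁻¹
  let U : V → (σ → k) → k := (measure ρ).wf.fix F
  have hUI : ∀ (x : V) (hx : x ∈ I), U x = fun p => p (Sum.inr ⟨x, hx⟩) := by
    intro x hx
    refine ((measure ρ).wf.fix_eq F x).trans ?_
    simp only [F, dif_pos hx]
  have hUq : ∀ q, U (corner q (t q)) =
      (-rest (coef q) (t q) (fun i => U (corner q i))) *
        (lead (coef q) (t q) (fun i => U (corner q i)))⁻¹ := by
    intro q
    obtain ⟨⟨x, hx⟩, rfl⟩ := e.surjective q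
    have hex := he ⟨x, hx⟩
    dsimp only at hex
    rw [hex]
    refine ((measure ρ).wf.fix_eq F x).trans ?_
    simp only [F, dif_neg hx]
    have hlt : ∀ i, i ≠ t (e ⟨x, hx⟩) → ρ (corner (e ⟨x, hx⟩) i) < ρ x := fun i hi => by
      have := hρ _ i hi
      rwa [hex] at this
    rw [lead_congr _ fun i hi => dif_pos (hlt i hi), rest_congr _ fun i hi => dif_pos (hlt i hi)]
  have hlead₀ : ∀ q, lead (coef q) (t q) (fun i => U (corner q i)) p₀ = 1 := fun q => by
    rw [lead_apply]
    exact lead_indicator (t q) _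
  have hU : ∀ n x, ρ x = n → U x ∈ rationalAt p₀ := by
    intro n
    induction n using Nat.strong_induction_on with
    | _ n ih =>
      rintro x rfl
      by_cases hx : x ∈ I
      · rw [hUI x hx]
        exact coordinate_mem_rationalAt _ _
      · rw [show x = corner (e ⟨x, hx⟩) (t (e ⟨x, hx⟩)) from (he ⟨x, hx⟩).symm, hUq]
        have hv : ∀ i, i ≠ t (e ⟨x, hx⟩) → U (corner (e ⟨x, hx⟩) i) ∈ rationalAt p₀ :=
          fun i hi => ih _ (by simpa only [he] using hρ _ i hi) _ rfl
        exact mul_mem (neg_mem (rest_mem (fun A => coordinate_mem_rationalAt _ _) hv))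
          (inv_mem_rationalAt (lead_mem (fun A => coordinate_mem_rationalAt _ _) hv)
            (by rw [hlead₀]; exact one_ne_zero))
  have hT : ∀ q, ∃ T : MvPolynomial σ k, eval p₀ T ≠ 0 ∧ ∀ p, eval p T ≠ 0 →
      lead (coef q) (t q) (fun i => U (corner q i)) p ≠ 0 := fun q =>
    exists_eval_ne_zero_of_mem_rationalAt
      (lead_mem (fun A => coordinate_mem_rationalAt _ _) fun i _ => hU _ _ rfl)
      (by rw [hlead₀]; exact one_ne_zero)
  choose T hT₀ hT using hT
  -- The condition on the coefficients is the product of all `T q` at initial values 0. It is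
  -- nonzero because `p₀` also has initial values 0.
  have hevalP : ∀ c, eval c (aeval (Sum.elim X fun _ => 0) (∏ q, T q)) =
      eval (Sum.elim c fun _ => 0) (∏ q, T q) := by
    intro c
    rw [← coe_aeval_eq_eval, ← coe_aeval_eq_eval, RingHom.coe_coe, RingHom.coe_coe,
      ← AlgHom.comp_apply]
    congr 1
    ext (a | a) <;> simp
  refine ⟨aeval (Sum.elim X fun _ => 0) (∏ q, T q), ?_, fun c hc => ?_⟩
  · intro h0
    have := hevalP fun a => if a.2 = {t a.1} then 1 else 0
    rw [h0, map_zero, map_prod] at this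
    exact Finset.prod_ne_zero_iff.2 (fun q _ => hT₀ q) this.symm
  rw [hevalP] at hc
  have hevalR : ∀ w, eval w (aeval (Sum.elim (fun a => C (c a)) X) (∏ q, T q)) =
      eval (Sum.elim c w) (∏ q, T q) := by
    intro w
    rw [← coe_aeval_eq_eval, ← coe_aeval_eq_eval, RingHom.coe_coe, RingHom.coe_coe,
      ← AlgHom.comp_apply]
    congr 1
    ext (a | a) <;> simp
  refine ⟨aeval (Sum.elim (fun a => C (c a)) X) (∏ q, T q), ?_, fun w hw => ?_⟩
  -- At `w = 0` this polynomial takes the value that was required to be nonzero for `c`.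
  · intro h0
    have := hevalR fun _ => 0
    rw [h0, map_zero] at this
    exact hc this.symm
  rw [hevalR, map_prod, Finset.prod_ne_zero_iff] at hw
  have hlead : ∀ q, lead (fun A => c (q, A)) (t q) (fun i => U (corner q i) (Sum.elim c w)) ≠ 0 :=
    fun q => by
      have := hT q _ (hw q (Finset.mem_univ q))
      rwa [lead_apply] at this
  have hUq' : ∀ q, U (corner q (t q)) (Sum.elim c w) =
      -rest (fun A => c (q, A)) (t q) (fun i => U (corner q i) (Sum.elim c w)) *
        (lead (fun A => c (q, A)) (t q) (fun i => U (corner q i) (Sum.elim c w)))⁻¹ := by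
    intro q
    refine (congrFun (hUq q) _).trans ?_
    rw [Pi.mul_apply, Pi.neg_apply, Pi.inv_apply, rest_apply, lead_apply]
    rfl
  refine ⟨fun x => U x (Sum.elim c w), ⟨fun q => ?_, fun x => ?_⟩, ?_⟩
  · rw [sum_eq_lead_add_rest _ (t q)]
    dsimp only
    rw [hUq', inv_mul_cancel_right₀ (hlead q), neg_add_cancel]
  · simp only [hUI x x.2, Sum.elim_inr]
  · rintro u ⟨hu, huI⟩
    have : ∀ n x, ρ x = n → u x = U x (Sum.elim c w) := by
      intro n
      induction n using Nat.strong_induction_on with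
      | _ n ih =>
        rintro x rfl
        by_cases hx : x ∈ I
        · rw [hUI x hx]
          exact huI ⟨x, hx⟩
        · have h := hu (e ⟨x, hx⟩)
          have hv : ∀ i, i ≠ t (e ⟨x, hx⟩) → u (corner (e ⟨x, hx⟩) i) =
              U (corner (e ⟨x, hx⟩) i) (Sum.elim c w) :=
            fun i hi => ih _ (by simpa only [he] using hρ _ i hi) _ rfl
          rw [sum_eq_lead_add_rest _ (t (e ⟨x, hx⟩)), lead_congr _ hv, rest_congr _ hv] at h
          have h' := hUq' (e ⟨x, hx⟩)
          rw [he] at h h'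
          rw [h', ← div_eq_mul_inv, eq_div_iff (hlead _)]
          exact eq_neg_of_add_eq_zero_left h
    exact funext fun x => this _ x rfl

/-! ### From the ranking of vertices to well-posedness -/

namespace QuadGraph

variable {D : Type*} [Finite D] {G : QuadGraph D}

theorem exists_corner_eq_tail (q : G.Quad) {d : D} (hd : G.face d = q.1) :
    ∃ j, G.corner q j = G.tail d ∧ ∀ i, i ≠ j → ∃ d', G.face d' = G.face d ∧ d' ≠ d ∧
      G.corner q i = G.tail d' := by
  have hout : G.face (Quotient.out q.1) = q.1 := Quotient.out_eq _
  have hper := G.minimalPeriod_next (d := Quotient.out q.1) (by rw [hout]; exact q.2)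
  obtain ⟨n, hn⟩ := (G.face_eq_iff.1 (hout.trans hd.symm)).exists_nat_pow_eq
  rw [Equiv.Perm.coe_pow, ← Function.iterate_mod_minimalPeriod_eq, hper] at hn
  refine ⟨⟨n % 4, Nat.mod_lt _ (by norm_num)⟩, by rw [corner, Equiv.Perm.coe_pow, hn],
    fun i hi => ⟨(G.next ^ (i : ℕ)) (Quotient.out q.1), ?_, fun h => hi ?_, rfl⟩⟩
  · exact (G.face_eq_iff.2 ⟨(i : ℕ), by simp⟩).symm.trans (hout.trans hd.symm)
  · rw [Equiv.Perm.coe_pow, ← hn, Function.iterate_eq_iterate_iff_of_lt_minimalPeriod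
      (by rw [hper]; exact i.2) (by rw [hper]; exact Nat.mod_lt _ (by norm_num))] at h
    exact Fin.ext h

theorem genericallyWellPosed_of_ranked (k : Type*) [Field k] {I : Set G.Vertex}
    (h : G.Ranked I Set.univ) (hcard : Nat.card G.Quad + I.ncard ≤ Nat.card G.Vertex) :
    G.GenericallyWellPosed k I := by
  classical
  have := Fintype.ofFinite G.Quad
  have := Fintype.ofFinite G.Vertex
  obtain ⟨ρ, hρ⟩ := h
  have hx : ∀ x : {x // x ∉ I}, ∃ (q : G.Quad) (j : Fin 4), G.corner q j = x ∧
      ∀ i, i ≠ j → ρ (G.corner q i) < ρ x := by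
    rintro ⟨x, hx⟩
    obtain ⟨d, rfl, hd, h⟩ := (hρ x (Set.mem_univ x)).resolve_left hx
    obtain ⟨j, hj, hi⟩ := exists_corner_eq_tail ⟨G.face d, hd⟩ rfl
    refine ⟨⟨G.face d, hd⟩, j, hj, fun i hij => ?_⟩
    obtain ⟨d', h1, h2, h3⟩ := hi i hij
    rw [h3]
    exact (h d' h1 h2).2
  choose q j hj hlt using hx
  have hinj : Function.Injective q := by
    -- Two vertices assigned to one quad at different corners would each have smaller rank than the
    -- other.
    intro x y hxy
    by_contra hne
    have h1 : j x ≠ j y := fun h => hne (Subtype.ext (by rw [← hj x, ← hj y, hxy, h]))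
    have h2 := hlt x (j y) h1.symm
    have h3 := hlt y (j x) h1
    rw [hxy, hj] at h2
    rw [← hxy, hj] at h3
    exact lt_asymm h2 h3
  -- The counting inequality enters here: no quad is left over, so no relation overdetermines the
  -- solution.
  have hbij : Function.Bijective q := by
    refine (Fintype.bijective_iff_injective_and_card q).2 ⟨hinj, ?_⟩
    refine le_antisymm (Fintype.card_le_of_injective q hinj) ?_
    rw [← Nat.card_eq_fintype_card, ← Nat.card_eq_fintype_card]
    have h1 := Set.ncard_add_ncard_compl I
    have h2 : Nat.card {x // x ∉ I} = Iᶜ.ncard := rfl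
    omega
  let e := Equiv.ofBijective q hbij
  have ht : ∀ x, j (e.symm (e x)) = j x := fun x => by rw [e.symm_apply_apply]
  refine exists_unique_solution_of_triangular I G.corner (fun q => j (e.symm q)) ρ ?_ e
    (fun x => ?_)
  · intro q i hi
    obtain ⟨x, rfl⟩ := e.surjective q
    rw [ht] at hi ⊢
    exact (hlt x i hi).trans_eq (congrArg ρ (hj x).symm)
  · rw [ht]
    exact hj x

end QuadGraph

theorem mainTheorem1 {D : Type*} [Finite D] (k : Type*) [Field k] [Infinite k]
    (G : QuadGraph D) (hclosed : ∀ C : G.Strip, ¬ G.ClosedStrip C)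
    (m : ℕ) (hm : m + G.numInnerHoles = G.numStrips)
    (r : G.Run m) (huses : ∑ i, r.uses i = G.numInnerHoles)
    (hent : ∀ (i : Fin (m + 1)) (C : Set G.Strip), ¬ (r.state i).Entangled C) :
    (r.state (Fin.last m)).init.ncard + G.numInnerHoles = G.numStrips + 1 ∧
      G.GenericallyWellPosed k (r.state (Fin.last m)).init := by
  obtain ⟨hcard, hranked, -⟩ := r.invariants (Fin.last m)
  rw [Fin.val_last] at hcard
  refine ⟨by omega, QuadGraph.genericallyWellPosed_of_ranked k ?_ ?_⟩
  · rwa [r.known_last hm huses (hent _)] at hranked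
  · rw [hcard]
    exact G.card_quad_add_le hclosed hm
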